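/- Consider $n$ anonymous agents that communicate in synchronous rounds. A dynamic network of size $n$ is a sequence $(G_t)_{t\ge 1}$ of undirected multigraphs on the set of agents; it is connected if every $G_t$ is connected. Each agent has an input from a set $I$, which it can always read, and an internal state. All agents run the same deterministic local algorithm, which prescribes an initial state for each input. At round $t\ge1$ each agent sends a message, a function of its input and its state, through all its links in $G_t$, and computes its new state from its input, its state and the multiset of messages received. The output at the end of a round is a function of the input and the state. The Input Frequency function maps an input assignment $x$ to the function $a\mapsto |\{p : x(p)=a\}|/n$ on $I$. Theorem. There is a function $f:\mathbb N^3\to\mathbb N$ such that for every $n\ge 1$ and every set $I$ of inputs there is a local algorithm with the following properties. 1. (Universal, self-stabilizing, stabilization in $2n-2$ rounds.) In every connected dynamic network of size $n$, for all inputs in $I$ and for arbitrary initial states of the agents, at the end of every round $t\ge 2n-2$ every agent outputs the Input Frequency function of the inputs. 2. (Finite-state.) For every $M\in\mathbb N$ and every finite $J\subseteq I$ there is a set $F$ of states, each encodable (injectively) by at most $f(n,M,|J|)$ bits, that contains the prescribed initial states for the inputs in $J$ and is such that, in every connected dynamic network of size $n$ in which any two agents are joined by at most $M$ parallel links per round,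 and for all inputs in $J$: if all initial states are in $F$, then all states are in $F$ at all rounds; and for arbitrary initial states, all states are in $F$ at all rounds $t\ge 2n-2$. -/

import Mathlib

universe u

namespace AnonymousNetwork

/-- A finite undirected multigraph on the agents `V`: a multiset of links. Parallel links and
loops are allowed; `E.count s(p, q)` is the number of parallel links between `p` and `q`. -/
abbrev Multigraph (V : Type) : Type := Multiset (Sym2 V)

/-- Two distinct agents are adjacent if at least one link joins them. -/
def Multigraph.toSimpleGraph {V : Type} (E : Multigraph V) : SimpleGraph V :=
  SimpleGraph.fromRel fun p q => s(p, q) ∈ E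

/-- A dynamic network of `n` agents; `G t` is the multigraph of links at round `t + 1`. -/
abbrev DynamicNetwork (n : ℕ) : Type := ℕ → Multigraph (Fin n)

namespace DynamicNetwork

variable {n : ℕ}

/-- The network is connected at every round. -/
def IsConnected (G : DynamicNetwork n) : Prop :=
  ∀ t, (G t).toSimpleGraph.Connected

/-- At every round, any two agents are joined by at most `M` parallel links. -/
def MultiplicityLE (G : DynamicNetwork n) (M : ℕ) : Prop :=
  ∀ t p q, (G t).count s(p, q) ≤ M

end DynamicNetwork

/-- A deterministic local algorithm for anonymous agents with inputs in `I` and outputs in `O`.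
All agents run the same algorithm. An agent can always read its own input, which is not part of
its (corruptible) internal state. The messages received in a round form a multiset: they carry no
order and no information on the sender. -/
structure LocalAlgorithm (I : Type u) (O : Type u) where
  /-- the internal states of an agent -/
  State : Type u
  /-- the messages -/
  Message : Type u
  /-- the proper initial state, determined by the input -/
  init : I → State
  /-- the message sent through all incident links -/
  send : I → State → Message
  /-- the new state, from the input, the current state and the received messages -/
  update : I → State → Multiset Message → State
  /-- the output returned at the end of a round -/
  output : I → State → O

namespace LocalAlgorithm

variable {I O : Type u} {n : ℕ}

/-- The messages received by agent `p` through the links `E` when the agents have inputs `x` and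
states `s`: for every agent `q`, one copy of the message of `q` for each link between `p` and
`q`. -/
def received (A : LocalAlgorithm I O) (E : Multigraph (Fin n)) (x : Fin n → I)
    (s : Fin n → A.State) (p : Fin n) : Multiset A.Message :=
  ∑ q, E.count s(p, q) • {A.send (x q) (s q)}

/-- The states of all agents at the end of round `t`, in the execution on `G` with inputs `x` in
which the states at the end of round `0` are `s₀`. -/
def state (A : LocalAlgorithm I O) (G : DynamicNetwork n) (x : Fin n → I)
    (s₀ : Fin n → A.State) : ℕ → Fin n → A.State
  | 0 => s₀
  | t + 1 => fun p =>
      A.update (x p) (A.state G x s₀ t p) (A.received (G t) x (A.state G x s₀ t) p)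

/-- The output of agent `p` at the end of round `t`. -/
def outputAt (A : LocalAlgorithm I O) (G : DynamicNetwork n) (x : Fin n → I)
    (s₀ : Fin n → A.State) (t : ℕ) (p : Fin n) : O :=
  A.output (x p) (A.state G x s₀ t p)

/-- The algorithm computes the function `φ` of the inputs in a self-stabilizing manner in all
connected dynamic networks of `n` agents, and stabilizes in at most `T` rounds: for all inputs and
all (possibly corrupted) initial states, from round `T` on the output of every agent is the
correct one. -/
def SelfStabilizesIn (A : LocalAlgorithm I O) (n : ℕ) (φ : (Fin n → I) → O) (T : ℕ) : Prop :=
  ∀ (G : DynamicNetwork n), G.IsConnected → ∀ (x : Fin n → I) (s₀ : Fin n → A.State),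
    ∀ t ≥ T, ∀ p, A.outputAt G x s₀ t p = φ x

/-- The states in `F` can be encoded, without ambiguity, by at most `b` bits each. -/
def EncodableInBits (A : LocalAlgorithm I O) (F : Set A.State) (b : ℕ) : Prop :=
  ∃ enc : A.State → List Bool, Set.InjOn enc F ∧ ∀ s ∈ F, (enc s).length ≤ b

/-- The algorithm is finite-state in connected networks of `n` agents. For every bound `M` on the
number of parallel links and every finite set `J` of inputs there is a set `F` of states, each
encodable in at most `f M |J|` bits, such that in all networks with multiplicities at most `M` and
inputs in `J`:
* the proper initial states are in `F`, and an execution that starts in `F` never leaves `F`;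
* whatever the initial states are, all states are in `F` from round `T` on. -/
def FiniteState (A : LocalAlgorithm I O) (n : ℕ) (f : ℕ → ℕ → ℕ) (T : ℕ) : Prop :=
  ∀ (M : ℕ) (J : Finset I), ∃ F : Set A.State,
    A.EncodableInBits F (f M J.card) ∧
    (∀ a ∈ J, A.init a ∈ F) ∧
    ∀ (G : DynamicNetwork n), G.IsConnected → G.MultiplicityLE M →
      ∀ (x : Fin n → I), (∀ p, x p ∈ J) → ∀ (s₀ : Fin n → A.State),
        ((∀ p, s₀ p ∈ F) → ∀ t p, A.state G x s₀ t p ∈ F) ∧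
        (∀ t ≥ T, ∀ p, A.state G x s₀ t p ∈ F)

end LocalAlgorithm

/-- The Input Frequency function: the fraction of agents that have each input value. -/
noncomputable def inputFrequency {I : Type u} {n : ℕ} (x : Fin n → I) : I → ℚ :=
  fun a => (Nat.card {p : Fin n // x p = a} : ℚ) / n

end AnonymousNetwork

/-!
Let `N` be an upper bound on the number of agents. Every agent records everything it has received
in the last `L = 2 * N - 2` rounds; a record of length `k` is rebuilt from scratch in `k` rounds, so
after `L` rounds it is correct, whatever the initial states were. It remains to see that a view of
`L` rounds (the input together with the record) determines the input frequencies.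

* Let two connected networks share a view after `m` rounds. The agents of the first network whose
  view after `k` rounds is shared form a set that, as `k` decreases, absorbs in each step the
  neighbors of its members; hence it contains all `n` agents once `k + (n - 1) ≤ m`.
* If the inputs are not all equal, the partition into views starts with at least two classes, can
  only become finer, and has at most `n` classes, so it does not change in some round
  `k + 1 ≤ n - 1`. It is then equitable for the links of that round. Counting the links between
  two classes from both sides shows that its quotient matrix determines the class sizes up to a
  common factor.
-/

namespace AnonymousNetwork

open scoped Finset

section ConnectedGraph

variable {V : Type*} {H : SimpleGraph V}

theorem eq_of_connected_of_forall_adj {α : Type*} {f : V → α} (hH : H.Connected)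
    (hf : ∀ p q, H.Adj p q → f p = f q) (p q : V) : f p = f q := by
  obtain ⟨w⟩ := hH.preconnected p q
  induction w with
  | nil => rfl
  | cons hadj _ ih => exact (hf _ _ hadj).trans ih

theorem ssubset_of_connected_of_forall_adj_mem {S T : Set V} (hH : H.Connected)
    (hS : S.Nonempty) (hST : S ⊆ T) (hadj : ∀ p ∈ S, ∀ q, H.Adj p q → q ∈ T)
    (hT : T ≠ Set.univ) : S ⊂ T := by
  obtain ⟨p, hp⟩ := hS
  obtain ⟨q, hq⟩ := (Set.ne_univ_iff_exists_notMem T).1 hT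
  obtain ⟨w⟩ := hH.preconnected p q
  obtain ⟨d, -, hfst, hsnd⟩ := w.exists_boundary_dart S hp fun h => hq (hST h)
  exact ⟨hST, fun hTS => hsnd (hTS (hadj _ hfst _ d.adj))⟩

end ConnectedGraph

section Fibers

theorem factorsThrough_of_ncard_range_le {V α β : Type*} [Finite V] {f : V → α} {g : V → β}
    {π : β → α} (hf : f = π ∘ g) (h : (Set.range g).ncard ≤ (Set.range f).ncard) :
    g.FactorsThrough f := by
  have himage : Set.range f = π '' Set.range g := by rw [hf, Set.range_comp]
  have hinj : Set.InjOn π (Set.range g) :=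
    (Set.ncard_image_iff (Set.finite_range g)).1
      ((Set.ncard_image_le (Set.finite_range g)).antisymm (himage ▸ h))
  intro p q hpq
  rw [hf] at hpq
  exact hinj (Set.mem_range_self p) (Set.mem_range_self q) hpq

theorem exists_succ_le_of_forall_le {c : ℕ → ℕ} {a b : ℕ} (ha : a ≤ c 0) (hb : ∀ k, c k ≤ b) :
    ∃ k, k + a ≤ b ∧ c (k + 1) ≤ c k := by
  by_contra! hlt
  have hgrow : ∀ k, k + a ≤ b + 1 → k + a ≤ c k := by
    intro k
    induction k with
    | zero => exact fun _ => (zero_add a).trans_le ha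
    | succ k ih =>
      intro hk
      have := ih (by omega)
      have := hlt k (by omega)
      omega
  have hab := ha.trans (hb 0)
  have := hgrow (b + 1 - a) (by omega)
  have := hb (b + 1 - a)
  omega

theorem card_fiber_comp {V N J : Type*} [Fintype V] [DecidableEq N] [DecidableEq J] (φ : V → N)
    (π : N → J) (a : J) {S : Finset N} (hS : ∀ p, φ p ∈ S) :
    #{p | π (φ p) = a} = ∑ A ∈ S with π A = a, #{p | φ p = A} := by
  rw [Finset.card_eq_sum_card_fiberwise (f := φ) (t := {A ∈ S | π A = a})
    fun p hp => by simpa [hS] using hp]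
  refine Finset.sum_congr rfl fun A hA => ?_
  rw [Finset.filter_filter]
  congr! 2 with p
  exact and_iff_right_of_imp fun hp => hp ▸ (Finset.mem_filter.1 hA).2

theorem card_fiber_comp_eq_mul {V V' N J : Type*} [Fintype V] [Fintype V'] [DecidableEq N]
    [DecidableEq J] {φ : V → N} {φ' : V' → N} {ρ : ℚ}
    (h : ∀ A, (#{p | φ' p = A} : ℚ) = ρ * #{p | φ p = A}) (π : N → J) (a : J) :
    (#{p | π (φ' p) = a} : ℚ) = ρ * #{p | π (φ p) = a} := by
  let S : Finset N := Finset.univ.image φ ∪ Finset.univ.image φ'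
  rw [card_fiber_comp φ' π a (S := S) (by simp [S]), card_fiber_comp φ π a (S := S) (by simp [S])]
  push_cast
  rw [Finset.mul_sum]
  exact Finset.sum_congr rfl fun A _ => h A

end Fibers

namespace Multigraph

variable {V : Type} {E : Multigraph V} {p q : V}

theorem mem_of_adj (h : E.toSimpleGraph.Adj p q) : s(p, q) ∈ E := by
  rcases (SimpleGraph.fromRel_adj _ _ _).1 h with ⟨-, h | h⟩
  · exact h
  · rwa [Sym2.eq_swap]

variable [Fintype V] [DecidableEq V] {α β : Type*} {f : V → α}

/-- The multiset that agent `p` receives through the links `E` when every agent `q` sends `f q`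
through each of its links. -/
def gather (E : Multigraph V) (f : V → α) (p : V) : Multiset α :=
  ∑ q, E.count s(p, q) • {f q}

theorem mem_gather {a : α} : a ∈ E.gather f p ↔ ∃ q, s(p, q) ∈ E ∧ f q = a := by
  simp only [gather, Multiset.mem_sum, Finset.mem_univ, true_and, Multiset.mem_nsmul,
    Multiset.mem_singleton, Multiset.count_ne_zero, eq_comm (a := a)]

theorem count_gather [DecidableEq α] (E : Multigraph V) (f : V → α) (p : V) (a : α) :
    (E.gather f p).count a = ∑ q with f q = a, E.count s(p, q) := by
  simp only [gather, Multiset.count_sum', Multiset.count_nsmul, Multiset.count_singleton,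
    Finset.sum_filter, mul_ite, mul_one, mul_zero, eq_comm (a := a)]

theorem map_gather (g : α → β) (E : Multigraph V) (f : V → α) (p : V) :
    (E.gather f p).map g = E.gather (g ∘ f) p := by
  simp only [gather, ← Multiset.coe_mapAddMonoidHom, map_sum, map_nsmul]
  rfl

theorem gather_le {S : Finset α} {M : ℕ} (hE : ∀ q, E.count s(p, q) ≤ M) (hf : ∀ q, f q ∈ S) :
    E.gather f p ≤ (Fintype.card V * M) • S.val :=
  calc ∑ q, E.count s(p, q) • {f q}
      ≤ ∑ _q : V, M • S.val := Finset.sum_le_sum fun q _ =>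
        (nsmul_le_nsmul_left (Multiset.zero_le _) (hE q)).trans
          (nsmul_le_nsmul_right (Multiset.singleton_le.2 (hf q)) M)
    _ = (Fintype.card V * M) • S.val := by
        rw [Finset.sum_const, Finset.card_univ, mul_nsmul']

/-- The partition of the agents into the classes `φ p = A` is equitable for the links `E`: the
multiset of the classes of the neighbors of an agent depends only on the class of the agent. The
quotient matrix is encoded by `m`, whose entry at `(A, B)` is `(m A).count B`. -/
def IsEquitable {N : Type*} (E : Multigraph V) (φ : V → N) (m : N → Multiset N) : Prop :=
  ∀ p, E.gather φ p = m (φ p)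

namespace IsEquitable

variable {V' : Type} [Fintype V'] [DecidableEq V'] {E' : Multigraph V'} {N : Type*}
  [DecidableEq N] {φ : V → N} {φ' : V' → N} {m : N → Multiset N}

theorem card_fiber_mul_count (h : E.IsEquitable φ m) (A B : N) :
    #{p | φ p = A} * (m A).count B = #{p | φ p = B} * (m B).count A := by
  have hcount : ∀ A B, #{p | φ p = A} * (m A).count B =
      ∑ p with φ p = A, ∑ q with φ q = B, E.count s(p, q) := by
    intro A B
    rw [← smul_eq_mul, ← Finset.sum_const]
    refine Finset.sum_congr rfl fun p hp => ?_
    rw [← (Finset.mem_filter.1 hp).2, ← h p, count_gather]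
  rw [hcount, hcount, Finset.sum_comm]
  simp only [Sym2.eq_swap]

theorem count_pos_of_adj (h : E.IsEquitable φ m) (hpq : E.toSimpleGraph.Adj p q) :
    0 < (m (φ p)).count (φ q) := by
  rw [← h p, Multiset.count_pos, mem_gather]
  exact ⟨q, mem_of_adj hpq, rfl⟩

theorem card_fiber_mul_card_fiber_of_adj (h : E.IsEquitable φ m) (h' : E'.IsEquitable φ' m)
    (hpq : E.toSimpleGraph.Adj p q) :
    #{r | φ' r = φ p} * #{r | φ r = φ q} = #{r | φ' r = φ q} * #{r | φ r = φ p} := by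
  refine Nat.eq_of_mul_eq_mul_right (h.count_pos_of_adj hpq.symm) ?_
  rw [mul_assoc, ← h.card_fiber_mul_count, mul_left_comm, h'.card_fiber_mul_count]
  ring

theorem exists_card_fiber_eq_mul (h : E.IsEquitable φ m) (h' : E'.IsEquitable φ' m)
    (hE : E.toSimpleGraph.Connected) (hφ : Set.range φ = Set.range φ') :
    ∃ ρ : ℚ, ρ ≠ 0 ∧ ∀ A, (#{p | φ' p = A} : ℚ) = ρ * #{p | φ p = A} := by
  have hpos : ∀ p, (#{r | φ r = φ p} : ℚ) ≠ 0 := fun p =>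
    Nat.cast_ne_zero.2 (Finset.card_ne_zero_of_mem (a := p) (by simp))
  have hratio := eq_of_connected_of_forall_adj (f := fun p =>
      (#{r | φ' r = φ p} : ℚ) / #{r | φ r = φ p}) hE fun p q hpq =>
    (div_eq_div_iff (hpos p) (hpos q)).2
      (mod_cast h.card_fiber_mul_card_fiber_of_adj h' hpq)
  obtain ⟨p₀⟩ := hE.nonempty
  refine ⟨(#{r | φ' r = φ p₀} : ℚ) / #{r | φ r = φ p₀}, div_ne_zero ?_ (hpos p₀), fun A => ?_⟩
  · obtain ⟨p₀', hp₀'⟩ : φ p₀ ∈ Set.range φ' := hφ ▸ Set.mem_range_self p₀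
    exact Nat.cast_ne_zero.2 (Finset.card_ne_zero_of_mem (a := p₀') (by simp [hp₀']))
  by_cases hA : A ∈ Set.range φ
  · obtain ⟨p, rfl⟩ := hA
    rw [hratio p₀ p, div_mul_cancel₀ _ (hpos p)]
  · have hA' : A ∉ Set.range φ' := hφ ▸ hA
    rw [Set.mem_range, not_exists] at hA hA'
    simp [hA, hA']

end IsEquitable

end Multigraph

section InputFrequency

variable {I : Type u} {n n' : ℕ}

theorem inputFrequency_apply [DecidableEq I] (x : Fin n → I) (a : I) :
    inputFrequency x a = (#{p | x p = a} : ℚ) / n := by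
  rw [inputFrequency, Nat.card_eq_fintype_card, Fintype.card_subtype]

theorem inputFrequency_comp_eq_of_card_fiber_eq_mul {N : Type*} [DecidableEq N]
    {φ : Fin n → N} {φ' : Fin n' → N} {ρ : ℚ} (hρ : ρ ≠ 0)
    (h : ∀ A, (#{p | φ' p = A} : ℚ) = ρ * #{p | φ p = A}) (π : N → I) :
    inputFrequency (π ∘ φ) = inputFrequency (π ∘ φ') := by
  classical
  have hn : (n' : ℚ) = ρ * n := by
    simpa using card_fiber_comp_eq_mul h (fun _ => ()) ()
  funext a
  simp only [inputFrequency_apply, Function.comp_apply]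
  rw [card_fiber_comp_eq_mul h π a, hn, mul_div_mul_left _ _ hρ]

theorem inputFrequency_const [NeZero n] [DecidableEq I] (a : I) :
    inputFrequency (fun _ : Fin n => a) = Pi.single a 1 := by
  funext b
  rw [inputFrequency_apply]
  obtain rfl | hb := eq_or_ne b a
  · simp
  · simp [hb, hb.symm]

end InputFrequency

/-- What an agent may have recorded during `k` rounds: its record of the first `k - 1` rounds and
the multiset of the inputs and records received in the last one. -/
def History (I : Type u) : ℕ → Type u
  | 0 => PUnit
  | k + 1 => History I k × Multiset (I × History I k)

/-- What an agent may know after `k` rounds: its input and its record. The input is kept apart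
because it is not part of the corruptible state. -/
abbrev View (I : Type u) (k : ℕ) : Type u := I × History I k

namespace View

variable {I : Type u} {k : ℕ}

/-- The view of the same agent one round earlier. -/
def prev (v : View I (k + 1)) : View I k := (v.1, v.2.1)

/-- The views received in the last round of a view. -/
def received (v : View I (k + 1)) : Multiset (View I k) := v.2.2

end View

namespace DynamicNetwork

variable {I : Type u} {n n' : ℕ}

/-- The record of agent `p` after the first `k` rounds of `G` with inputs `x`. -/
def history (G : DynamicNetwork n) (x : Fin n → I) : ∀ k, Fin n → History I k
  | 0, _ => PUnit.unit
  | k + 1, p => (G.history x k p, (G k).gather (fun q => (x q, G.history x k q)) p)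

/-- The view of agent `p` after the first `k` rounds of `G` with inputs `x`. -/
def view (G : DynamicNetwork n) (x : Fin n → I) (k : ℕ) (p : Fin n) : View I k :=
  (x p, G.history x k p)

theorem received_view_succ (G : DynamicNetwork n) (x : Fin n → I) (k : ℕ) (p : Fin n) :
    (G.view x (k + 1) p).received = (G k).gather (G.view x k) p := rfl

theorem prev_comp_view_succ (G : DynamicNetwork n) (x : Fin n → I) (k : ℕ) :
    View.prev ∘ G.view x (k + 1) = G.view x k := rfl

section CommonViews

/-- The agents of `G` whose view after `k` rounds is also the view of some agent of `G'`. -/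
def commonViewAgents (G : DynamicNetwork n) (x : Fin n → I) (G' : DynamicNetwork n')
    (x' : Fin n' → I) (k : ℕ) : Set (Fin n) :=
  G.view x k ⁻¹' Set.range (G'.view x' k)

variable {G : DynamicNetwork n} {x : Fin n → I} {G' : DynamicNetwork n'} {x' : Fin n' → I}

theorem antitone_commonViewAgents : Antitone (G.commonViewAgents x G' x') := by
  refine antitone_nat_of_succ_le fun k p => ?_
  rintro ⟨p', hp'⟩
  exact ⟨p', congrArg View.prev hp'⟩

theorem mem_commonViewAgents_of_adj {k : ℕ} {p q : Fin n}
    (hp : p ∈ G.commonViewAgents x G' x' (k + 1)) (hpq : (G k).toSimpleGraph.Adj p q) :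
    q ∈ G.commonViewAgents x G' x' k := by
  obtain ⟨p', hp'⟩ := hp
  have hq : G.view x k q ∈ (G.view x (k + 1) p).received :=
    Multigraph.mem_gather.2 ⟨q, Multigraph.mem_of_adj hpq, rfl⟩
  rw [← hp', received_view_succ, Multigraph.mem_gather] at hq
  obtain ⟨q', -, hq'⟩ := hq
  exact ⟨q', hq'⟩

theorem min_le_ncard_commonViewAgents (hG : G.IsConnected) {d k : ℕ}
    (h : (G.commonViewAgents x G' x' (k + d)).Nonempty) :
    min (d + 1) n ≤ (G.commonViewAgents x G' x' k).ncard := by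
  induction d generalizing k with
  | zero => exact (min_le_left _ _).trans ((Set.ncard_pos (Set.toFinite _)).2 h)
  | succ d ih =>
    by_cases huniv : G.commonViewAgents x G' x' k = Set.univ
    · rw [huniv, Set.ncard_univ, Nat.card_fin]
      exact min_le_right _ _
    have hsucc := ih (k := k + 1) (by rwa [add_assoc, add_comm 1 d])
    have hlt := Set.ncard_lt_ncard (ssubset_of_connected_of_forall_adj_mem (hG k)
      (h.mono (antitone_commonViewAgents (by omega)))
      (antitone_commonViewAgents (Nat.le_add_right k 1))
      (fun p hp q hpq => mem_commonViewAgents_of_adj hp hpq) huniv) (Set.toFinite _)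
    omega

theorem range_view_subset_of_view_eq (hG : G.IsConnected) {k m : ℕ} (hm : k + (n - 1) ≤ m)
    {p : Fin n} {p' : Fin n'} (h : G.view x m p = G'.view x' m p') :
    Set.range (G.view x k) ⊆ Set.range (G'.view x' k) := by
  have hne : (G.commonViewAgents x G' x' (k + (n - 1))).Nonempty :=
    ⟨p, antitone_commonViewAgents hm ⟨p', h.symm⟩⟩
  have hcard := min_le_ncard_commonViewAgents hG hne
  have huniv : G.commonViewAgents x G' x' k = Set.univ := by
    refine Set.eq_of_subset_of_ncard_le (Set.subset_univ _) ?_ (Set.toFinite _)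
    rw [Set.ncard_univ, Nat.card_fin]
    omega
  exact Set.range_subset_iff.2 (Set.eq_univ_iff_forall.1 huniv)

theorem range_view_eq_of_view_eq (hG : G.IsConnected) (hG' : G'.IsConnected) {k m : ℕ}
    (hn : k + (n - 1) ≤ m) (hn' : k + (n' - 1) ≤ m) {p : Fin n} {p' : Fin n'}
    (h : G.view x m p = G'.view x' m p') :
    Set.range (G.view x k) = Set.range (G'.view x' k) :=
  (range_view_subset_of_view_eq hG hn h).antisymm (range_view_subset_of_view_eq hG' hn' h.symm)

end CommonViews

section StablePartition

variable {G : DynamicNetwork n} {x : Fin n → I}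

theorem exists_view_succ_factorsThrough (G : DynamicNetwork n) {p q : Fin n} (hpq : x p ≠ x q) :
    ∃ k, k + 2 ≤ n ∧ (G.view x (k + 1)).FactorsThrough (G.view x k) := by
  have htwo : 2 ≤ (Set.range (G.view x 0)).ncard :=
    (Set.one_lt_ncard (Set.finite_range _)).2 ⟨_, Set.mem_range_self p, _, Set.mem_range_self q,
      fun h => hpq (congrArg Prod.fst h)⟩
  have hle : ∀ k, (Set.range (G.view x k)).ncard ≤ n := fun k => by
    simpa using Finite.card_range_le (G.view x k)
  obtain ⟨k, hk, hcard⟩ := exists_succ_le_of_forall_le htwo hle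
  exact ⟨k, hk, factorsThrough_of_ncard_range_le (G.prev_comp_view_succ x k).symm hcard⟩

theorem isEquitable_view {k : ℕ} {e : View I k → View I (k + 1)}
    (he : ∀ p, G.view x (k + 1) p = e (G.view x k p)) :
    (G k).IsEquitable (G.view x k) fun A => (e A).received := fun p => by
  rw [← received_view_succ, he]

theorem inputFrequency_eq_of_factorsThrough {k : ℕ} (hG : (G k).toSimpleGraph.Connected)
    (hfac : (G.view x (k + 1)).FactorsThrough (G.view x k)) {G' : DynamicNetwork n'}
    {x' : Fin n' → I} (hrange : Set.range (G.view x (k + 1)) = Set.range (G'.view x' (k + 1))) :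
    inputFrequency x = inputFrequency x' := by
  classical
  have hrange_prev : Set.range (G.view x k) = Set.range (G'.view x' k) := by
    rw [← G.prev_comp_view_succ, ← G'.prev_comp_view_succ, Set.range_comp, hrange, Set.range_comp]
  have : Nonempty (View I (k + 1)) := hG.nonempty.map (G.view x (k + 1))
  obtain ⟨e, he_comp⟩ := (Function.factorsThrough_iff _).1 hfac
  have he : ∀ p, G.view x (k + 1) p = e (G.view x k p) := congrFun he_comp
  have he' : ∀ p', G'.view x' (k + 1) p' = e (G'.view x' k p') := fun p' => by
    obtain ⟨p, hp⟩ : G'.view x' (k + 1) p' ∈ Set.range (G.view x (k + 1)) :=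
      hrange ▸ Set.mem_range_self p'
    rw [← hp, he]
    exact congrArg (e ∘ View.prev) hp
  obtain ⟨ρ, hρ, hcard⟩ :=
    (isEquitable_view he).exists_card_fiber_eq_mul (isEquitable_view he') hG hrange_prev
  exact inputFrequency_comp_eq_of_card_fiber_eq_mul hρ hcard Prod.fst

end StablePartition

theorem inputFrequency_eq_of_view_eq {N : ℕ} (hn : n ≤ N) (hn' : n' ≤ N)
    {G : DynamicNetwork n} {G' : DynamicNetwork n'} (hG : G.IsConnected) (hG' : G'.IsConnected)
    {x : Fin n → I} {x' : Fin n' → I} {p : Fin n} {p' : Fin n'}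
    (h : G.view x (2 * N - 2) p = G'.view x' (2 * N - 2) p') :
    inputFrequency x = inputFrequency x' := by
  classical
  by_cases hx : ∀ q, x q = x p
  · have hx' : ∀ q', x' q' = x p := fun q' => by
      obtain ⟨q, hq⟩ := range_view_subset_of_view_eq (k := 0) hG' (by omega) h.symm
        (Set.mem_range_self q')
      exact (congrArg Prod.fst hq).symm.trans (hx q)
    have : NeZero n := ⟨(Fin.pos p).ne'⟩
    have : NeZero n' := ⟨(Fin.pos p').ne'⟩
    rw [funext hx, funext hx', inputFrequency_const, inputFrequency_const]
  · push Not at hx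
    obtain ⟨q, hq⟩ := hx
    obtain ⟨k, hk, hfac⟩ := G.exists_view_succ_factorsThrough hq
    exact inputFrequency_eq_of_factorsThrough (hG k) hfac
      (range_view_eq_of_view_eq hG hG' (by omega) (by omega) h)

theorem exists_forall_apply_view_eq_inputFrequency (I : Type u) (N : ℕ) :
    ∃ out : View I (2 * N - 2) → I → ℚ, ∀ n ≤ N, ∀ G : DynamicNetwork n, G.IsConnected →
      ∀ (x : Fin n → I) (p : Fin n), out (G.view x (2 * N - 2) p) = inputFrequency x := by
  have hval : ∀ v : View I (2 * N - 2), ∃ φ : I → ℚ, ∀ n ≤ N, ∀ G : DynamicNetwork n,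
      G.IsConnected → ∀ (x : Fin n → I) (p : Fin n),
        G.view x (2 * N - 2) p = v → φ = inputFrequency x := by
    intro v
    by_cases hv : ∃ n ≤ N, ∃ G : DynamicNetwork n, G.IsConnected ∧
        ∃ (x : Fin n → I) (p : Fin n), G.view x (2 * N - 2) p = v
    · obtain ⟨n, hn, G, hG, x, p, rfl⟩ := hv
      exact ⟨inputFrequency x, fun n' hn' G' hG' x' p' h =>
        inputFrequency_eq_of_view_eq hn hn' hG hG' h.symm⟩
    · exact ⟨0, fun n hn G hG x p h => (hv ⟨n, hn, G, hG, x, p, h⟩).elim⟩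
  choose out hout using hval
  exact ⟨out, fun n hn G hG x p => hout _ n hn G hG x p rfl⟩

/-- The network `G` from round `t + 1` on. -/
def shift (G : DynamicNetwork n) (t : ℕ) : DynamicNetwork n := fun i => G (t + i)

end DynamicNetwork

theorem card_Iic_nsmul_le {α : Type*} [DecidableEq α] (C : ℕ) (S : Finset α) :
    #(Finset.Iic (C • S.val)) ≤ (C + 1) ^ #S := by
  have hcount : ∀ a, (C • S.val).count a ≤ C := fun a => by
    rw [Multiset.count_nsmul]
    exact mul_le_of_le_one_right (Nat.zero_le C) (Multiset.nodup_iff_count_le_one.1 S.nodup a)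
  have hsub : (C • S.val).toFinset ⊆ S := fun a ha =>
    Multiset.mem_of_mem_nsmul (Multiset.mem_toFinset.1 ha)
  calc #(Finset.Iic (C • S.val))
      = ∏ a ∈ (C • S.val).toFinset, ((C • S.val).count a + 1) := Multiset.card_Iic _
    _ ≤ (C + 1) ^ #(C • S.val).toFinset :=
      Finset.prod_le_pow_card _ _ _ fun a _ => Nat.succ_le_succ (hcount a)
    _ ≤ (C + 1) ^ #S := Nat.pow_le_pow_right C.succ_pos (Finset.card_le_card hsub)

section BoundedHistories

variable {I : Type u}

/-- The record of an agent that has received nothing in any round. -/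
def emptyHistory (I : Type u) : ∀ k, History I k
  | 0 => PUnit.unit
  | k + 1 => (emptyHistory I k, 0)

open Classical in
/-- The records of `k` rounds with inputs in `J` in which every message is received at most `C`
times per round. -/
noncomputable def boundedHistories (C : ℕ) (J : Finset I) : ∀ k, Finset (History I k)
  | 0 => {PUnit.unit}
  | k + 1 => boundedHistories C J k ×ˢ Finset.Iic (C • (J ×ˢ boundedHistories C J k).val)

/-- An upper bound on the number of bounded records of `k` rounds with `j` inputs, obtained from
the at most `(C + 1) ^ (j * b)` multisets with multiplicities at most `C` on `j * b` messages. -/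
def historyBound (C j : ℕ) : ℕ → ℕ
  | 0 => 1
  | k + 1 => historyBound C j k * (C + 1) ^ (j * historyBound C j k)

variable {C : ℕ} {J : Finset I} {k : ℕ}

theorem mem_boundedHistories_zero (h : History I 0) : h ∈ boundedHistories C J 0 :=
  Finset.mem_singleton_self _

theorem mem_boundedHistories_succ {h : History I (k + 1)} :
    h ∈ boundedHistories C J (k + 1) ↔
      h.1 ∈ boundedHistories C J k ∧ h.2 ≤ C • (J ×ˢ boundedHistories C J k).val := by
  classical
  exact Finset.mem_product.trans (and_congr_right fun _ => Finset.mem_Iic)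

theorem emptyHistory_mem_boundedHistories (C : ℕ) (J : Finset I) (k : ℕ) :
    emptyHistory I k ∈ boundedHistories C J k := by
  induction k with
  | zero => exact mem_boundedHistories_zero _
  | succ k ih => exact mem_boundedHistories_succ.2 ⟨ih, Multiset.zero_le _⟩

theorem card_boundedHistories_le (C : ℕ) (J : Finset I) (k : ℕ) :
    #(boundedHistories C J k) ≤ historyBound C #J k := by
  classical
  induction k with
  | zero => exact le_rfl
  | succ k ih =>
    calc #(boundedHistories C J (k + 1))
        = #(boundedHistories C J k) * #(Finset.Iic (C • (J ×ˢ boundedHistories C J k).val)) :=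
          Finset.card_product _ _
      _ ≤ #(boundedHistories C J k) * (C + 1) ^ (#J * #(boundedHistories C J k)) := by
          rw [← Finset.card_product J]
          exact Nat.mul_le_mul_left _ (card_Iic_nsmul_le C _)
      _ ≤ historyBound C #J k * (C + 1) ^ (#J * historyBound C #J k) := by
          gcongr
          exact C.succ_pos

theorem gather_mem_boundedHistories {n M : ℕ} (hC : n * M ≤ C) {E : Multigraph (Fin n)}
    {x : Fin n → I} (hx : ∀ q, x q ∈ J) {p : Fin n} (hE : ∀ q, E.count s(p, q) ≤ M)
    {h : Fin n → History I k} (hh : ∀ q, h q ∈ boundedHistories C J k) :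
    ((h p, E.gather (fun q => (x q, h q)) p) : History I (k + 1)) ∈
      boundedHistories C J (k + 1) := by
  refine mem_boundedHistories_succ.2 ⟨hh p, ?_⟩
  refine (Multigraph.gather_le hE fun q => Finset.mk_mem_product (hx q) (hh q)).trans ?_
  rw [Fintype.card_fin]
  exact nsmul_le_nsmul_left (Multiset.zero_le _) hC

theorem history_mem_boundedHistories {n M : ℕ} (hC : n * M ≤ C) {G : DynamicNetwork n}
    (hG : G.MultiplicityLE M) {x : Fin n → I} (hx : ∀ q, x q ∈ J) (k : ℕ) (p : Fin n) :
    G.history x k p ∈ boundedHistories C J k := by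
  induction k generalizing p with
  | zero => exact mem_boundedHistories_zero _
  | succ k ih => exact gather_mem_boundedHistories hC hx (hG k p) ih

end BoundedHistories

theorem LocalAlgorithm.encodableInBits_of_card_le {I O : Type u} (A : LocalAlgorithm I O)
    {F : Finset A.State} {b : ℕ} (hF : #F ≤ 2 ^ b) : A.EncodableInBits F b := by
  obtain ⟨e⟩ : Nonempty (F ↪ List.Vector Bool b) :=
    Function.Embedding.nonempty_of_card_le (by simpa using hF)
  have henc : ∀ s : F, Function.extend Subtype.val (fun s => (e s).toList) (fun _ => []) s.1 =
      (e s).toList := Subtype.val_injective.extend_apply _ _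
  refine ⟨Function.extend Subtype.val (fun s => (e s).toList) fun _ => [], ?_, ?_⟩
  · intro s hs s' hs' h
    rw [henc ⟨s, hs⟩, henc ⟨s', hs'⟩] at h
    exact congrArg Subtype.val (e.injective (Subtype.ext h))
  · intro s hs
    rw [henc ⟨s, hs⟩, List.Vector.toList_length]

/-- The number of bits for a family of bounded records, one of each length `k ≤ L`, with `j` inputs
and with every message received at most `C` times per round. -/
def recordBits (L C j : ℕ) : ℕ := Nat.clog 2 (∏ k : Fin (L + 1), historyBound C j k)

section FullInformation

variable {I O : Type u} {L n : ℕ} {out : View I L → O}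

/-- The algorithm in which every agent keeps its records of the last `k` rounds for all `k ≤ L`,
sends them together with its input, and applies `out` to its view of the last `L` rounds. The
shorter records make the algorithm self-stabilizing: the new record of `k + 1` rounds is computed
from records of `k` rounds only. -/
def fullInformation (out : View I L → O) : LocalAlgorithm I O where
  State := ∀ k : Fin (L + 1), History I k
  Message := I × ∀ k : Fin (L + 1), History I k
  init _ k := emptyHistory I k
  send := Prod.mk
  update _ s ms := Fin.cases PUnit.unit fun k : Fin L =>
    (s k.castSucc, ms.map fun m => (m.1, m.2 k.castSucc))
  output a s := out (a, s (Fin.last L))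

theorem fullInformation_state_succ (G : DynamicNetwork n) (x : Fin n → I)
    (s₀ : Fin n → (fullInformation out).State) (t : ℕ) (p : Fin n) (k : Fin L) :
    (fullInformation out).state G x s₀ (t + 1) p k.succ =
      ((fullInformation out).state G x s₀ t p k.castSucc, (G t).gather
        (fun q => (x q, (fullInformation out).state G x s₀ t q k.castSucc)) p) :=
  Prod.ext rfl (Multigraph.map_gather _ _ _ _)

theorem fullInformation_state_add (G : DynamicNetwork n) (x : Fin n → I)
    (s₀ : Fin n → (fullInformation out).State) (t : ℕ) (k : Fin (L + 1)) (p : Fin n) :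
    (fullInformation out).state G x s₀ (t + k) p k = (G.shift t).history x k p := by
  induction k using Fin.induction generalizing p with
  | zero => rfl
  | succ k ih =>
    refine (fullInformation_state_succ G x s₀ (t + k) p k).trans ?_
    simp only [Fin.val_castSucc] at ih
    simp only [ih]
    rfl

theorem fullInformation_selfStabilizesIn {φ : (Fin n → I) → O}
    (hout : ∀ G : DynamicNetwork n, G.IsConnected → ∀ x p, out (G.view x L p) = φ x) :
    (fullInformation out).SelfStabilizesIn n φ L := by
  intro G hG x s₀ t ht p
  obtain ⟨t, rfl⟩ := Nat.exists_eq_add_of_le' ht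
  rw [← hout (G.shift t) (fun i => hG (t + i)) x p]
  exact congrArg (fun h => out (x p, h)) (fullInformation_state_add G x s₀ t (Fin.last L) p)

theorem fullInformation_finiteState {N : ℕ} (hn : n ≤ N) :
    (fullInformation out).FiniteState n (fun M => recordBits L (N * M)) L := by
  intro M J
  have hC : n * M ≤ N * M := Nat.mul_le_mul_right M hn
  let F : Finset (fullInformation out).State :=
    Fintype.piFinset fun k => boundedHistories (N * M) J k
  have hcard : #F ≤ ∏ k : Fin (L + 1), historyBound (N * M) #J k :=
    (Fintype.card_piFinset _).trans_le
      (Finset.prod_le_prod' fun k _ => card_boundedHistories_le _ _ _)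
  refine ⟨F, LocalAlgorithm.encodableInBits_of_card_le _
    (hcard.trans (Nat.le_pow_clog one_lt_two _)),
    fun a _ => Fintype.mem_piFinset.2 fun k => emptyHistory_mem_boundedHistories _ _ _, ?_⟩
  intro G _ hM x hx s₀
  refine ⟨fun h₀ t => ?_, fun t ht p => Fintype.mem_piFinset.2 fun k => ?_⟩
  · induction t with
    | zero => exact h₀
    | succ t ih =>
      refine fun p => Fintype.mem_piFinset.2 (Fin.cases (mem_boundedHistories_zero _) fun k => ?_)
      rw [fullInformation_state_succ]
      exact gather_mem_boundedHistories hC hx (hM t p) fun q =>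
        Fintype.mem_piFinset.1 (ih q) k.castSucc
  · obtain ⟨t, rfl⟩ := Nat.exists_eq_add_of_le' (k.is_le.trans ht)
    rw [fullInformation_state_add]
    exact history_mem_boundedHistories hC (fun i => hM (t + i)) hx k p

end FullInformation

end AnonymousNetwork

open AnonymousNetwork in
theorem theorem1_general :
    ∃ f : ℕ → ℕ → ℕ → ℕ, ∀ (N : ℕ) (I : Type u), ∃ A : LocalAlgorithm I (I → ℚ), ∀ n ≤ N,
      A.SelfStabilizesIn n inputFrequency (2 * N - 2) ∧ A.FiniteState n (f N) (2 * N - 2) := by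
  refine ⟨fun N M => recordBits (2 * N - 2) (N * M), fun N I => ?_⟩
  obtain ⟨out, hout⟩ := DynamicNetwork.exists_forall_apply_view_eq_inputFrequency I N
  exact ⟨fullInformation out, fun n hn =>
    ⟨fullInformation_selfStabilizesIn (hout n hn), fullInformation_finiteState hn⟩⟩

theorem theorem1 :
    ∃ f : ℕ → ℕ → ℕ → ℕ, ∀ n : ℕ, 1 ≤ n → ∀ I : Type u,
      ∃ A : AnonymousNetwork.LocalAlgorithm I (I → ℚ),
        A.SelfStabilizesIn n AnonymousNetwork.inputFrequency (2 * n - 2) ∧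
        A.FiniteState n (f n) (2 * n - 2) :=
  let ⟨f, hf⟩ := theorem1_general
  ⟨f, fun n _ I => (hf n I).imp fun _ hA => hA n le_rfl⟩
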